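/- All graphs are finite, simple and undirected. For a graph $G$, let $\alpha(G)$ be the maximum size of an independent set, let $\mathrm{core}(G)$ be the intersection and $\mathrm{corona}(G)$ the union of all maximum independent sets of $G$. An odd cycle of $G$ is a subgraph of $G$ that is a cycle of odd length. Let $M$ be a matching of $G$. A path is $M$-alternating if of any two consecutive edges exactly one lies in $M$. An $M$-blossom is an odd cycle of length $2k+1$ with exactly $k$ edges in $M$; its base is the vertex of the cycle that is incident to none of these $k$ edges. An $M$-flower with blossom $C$ is the union of an $M$-blossom $C$ and an $M$-alternating path of even length (possibly zero) from the base of $C$ to a vertex not saturated by $M$, where the base is the only common vertex of the path and $C$. For an odd cycle $C$ of $G$, the reach set $R(C)$ is the union of the vertex sets $V(F)$ over all maximum matchings $M$ of $G$ and all $M$-flowers $F$ of $G$ with blossom $C$. The graph $G$ is $R$-disjoint if it has at least one odd cycle, $R(C)\neq\emptyset$ for every odd cycle $C$ of $G$, and $R(C)\cap R(C')=\emptyset$ for every two distinct odd cycles $C,C'$ of $G$. (In particular, the odd cycles of an $R$-disjoint graph are pairwise vertex-disjoint.) Theorem. If $G$ is an $R$-disjoint graph with exactly $k$ odd cycles,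 then $$|\mathrm{corona}(G)|+|\mathrm{core}(G)|=2\alpha(G)+k.$$ -/

import Mathlib

namespace RDisjointGraph

variable {V : Type*}

/-- The intersection of all maximum independent sets of `G`. -/
def core [Finite V] (G : SimpleGraph V) : Set V :=
  {v | ∀ S : Finset V, G.IsMaximumIndepSet S → v ∈ S}

/-- The union of all maximum independent sets of `G`. -/
def corona [Finite V] (G : SimpleGraph V) : Set V :=
  {v | ∃ S : Finset V, G.IsMaximumIndepSet S ∧ v ∈ S}

/-- `C` is an odd cycle of `G`. Cycles are subgraphs, so that neither the starting vertex nor the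
direction of a traversal matters. -/
def IsOddCycle (G : SimpleGraph V) (C : G.Subgraph) : Prop :=
  ∃ (u : V) (p : G.Walk u u), p.IsCycle ∧ Odd p.length ∧ C = p.toSubgraph

/-- `M` is a matching of `G` of maximum cardinality. The vertices saturated by `M` are `M.verts`. -/
def IsMaximumMatching (G : SimpleGraph V) (M : G.Subgraph) : Prop :=
  M.IsMatching ∧ ∀ M' : G.Subgraph, M'.IsMatching → M'.edgeSet.ncard ≤ M.edgeSet.ncard

/-- Of any two consecutive edges of the walk `p`, exactly one belongs to `M`. -/
def IsAlternating {G : SimpleGraph V} (M : G.Subgraph) {u v : V} (p : G.Walk u v) : Prop :=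
  p.edges.IsChain fun e f => (e ∈ M.edgeSet ↔ f ∉ M.edgeSet)

/-- `C` is an `M`-blossom: an odd cycle of length `2k+1` with exactly `k` edges in `M`. -/
def IsBlossom {G : SimpleGraph V} (M C : G.Subgraph) : Prop :=
  IsOddCycle G C ∧ C.edgeSet.ncard = 2 * (C.edgeSet ∩ M.edgeSet).ncard + 1

/-- `b` is a base of the blossom `C`: a vertex of `C` incident to no edge of `C` in `M`. -/
def IsBase {G : SimpleGraph V} (M C : G.Subgraph) (b : V) : Prop :=
  b ∈ C.verts ∧ ∀ w, C.Adj b w → ¬ M.Adj b w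

/-- `p` is an `M`-stem of the blossom `C`: an `M`-alternating path of even length (possibly zero)
from the base of `C` to a vertex not saturated by `M`, meeting `C` only in the base. -/
structure IsStem {G : SimpleGraph V} (M C : G.Subgraph) {b r : V} (p : G.Walk b r) : Prop where
  isBase : IsBase M C b
  isPath : p.IsPath
  even_length : Even p.length
  isAlternating : IsAlternating M p
  root_unsaturated : r ∉ M.verts
  inter_eq : ∀ x ∈ p.support, x ∈ C.verts → x = b

/-- `F` is an `M`-flower with blossom `C`: the union of `C` and an `M`-stem of `C`. -/
def IsFlower {G : SimpleGraph V} (M C F : G.Subgraph) : Prop :=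
  IsBlossom M C ∧ ∃ (b r : V) (p : G.Walk b r), IsStem M C p ∧ F = C ⊔ p.toSubgraph

/-- The reach set `R(C)`: the union of the vertex sets of all `M`-flowers with blossom `C`,
over all maximum matchings `M`. -/
def reach {G : SimpleGraph V} (C : G.Subgraph) : Set V :=
  {x | ∃ M F : G.Subgraph, IsMaximumMatching G M ∧ IsFlower M C F ∧ x ∈ F.verts}

/-- `G` has at least one odd cycle, every odd cycle has a nonempty reach set, and distinct odd
cycles have disjoint reach sets. -/
structure IsRDisjoint (G : SimpleGraph V) : Prop where
  exists_oddCycle : ∃ C : G.Subgraph, IsOddCycle G C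
  reach_nonempty : ∀ C : G.Subgraph, IsOddCycle G C → (reach C).Nonempty
  reach_disjoint : ∀ C C' : G.Subgraph, IsOddCycle G C → IsOddCycle G C' → C ≠ C' →
    Disjoint (reach C) (reach C')

end RDisjointGraph

open SimpleGraph

/-!
The proof counts along a maximum matching `M` no edge of which leaves an odd cycle.

Call a vertex inessential if some maximum matching misses it. The symmetric difference of two
maximum matchings `M` and `N` yields, for each vertex `v` missed by `N`, an alternating path of even
length from `v` to a vertex missed by `M` (`IsMaximumMatching.exists_isSwitch`). Two consequences
determine the structure of `G`. If both ends of an edge are inessential, then the path between them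
closes up to an odd cycle through that edge (`exists_isOddCycle_of_adj`). As a blossom with a flower
can be rotated, every vertex of an odd cycle is inessential; since the odd cycles of an `R`-disjoint
graph are pairwise disjoint, each of them is a connected component of the graph induced by the
inessential vertices, and the remaining inessential vertices are isolated in it. Moreover, if `M`
has an edge that leaves an odd cycle `C`, then `M` is nearly perfect on `C`, and the path starting
with this edge is a stem of the blossom `C`. It lies in the reach set of `C`, so it avoids the other
odd cycles, and switching along it frees `C` without affecting them. Hence some maximum matching `M`
has no edge leaving an odd cycle (`IsRDisjoint.exists_isMaximumMatching`).

Let `X` be the set of vertices missed by `M` that lie on no odd cycle. Given an independent set `I`,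
`M` can be changed inside the odd cycles so as to miss a vertex outside `I` in each of them, and
counting along the edges gives `2|I| + k ≤ |V| + |X|`. Equality is attained by the inessential
vertices on no odd cycle together with a suitable colour class of the rest, which is bipartite once
a vertex is removed from each odd cycle (`IsRDisjoint.exists_isIndepSet`); here one uses that `M`
matches the neighbours of the inessential vertices to inessential vertices. So
`2α(G) + k = |V| + |X|`, and every maximum independent set contains `X` and exactly one end of each
edge of `M` outside the odd cycles. For such an edge `xy`, the vertex `x` is in the corona if and
only if `y` is not in the core, so the edge contributes `2` to the sum of the two cardinalities, as
does each vertex of `X`. Each vertex of an odd cycle contributes `1`, because the vertex missed on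
the cycle can be chosen freely. The total is `|V| + |X|`.
-/

namespace RDisjointGraph

/-! ### Maximum matchings and their modifications -/

section Matchings

variable {V : Type*} {G : SimpleGraph V} {M N : G.Subgraph}

lemma two_mul_ncard_edgeSet [Finite V] (h : M.IsMatching) :
    2 * M.edgeSet.ncard = M.verts.ncard := by
  classical
  have := Fintype.ofFinite V
  rw [Subgraph.isMatching_iff_forall_degree] at h
  have h1 : M.spanningCoe.edgeSet = M.edgeSet := by
    ext e; induction e with | _ x y => simp
  rw [← h1, ← SimpleGraph.coe_edgeFinset, Set.ncard_coe_finset,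
    ← SimpleGraph.sum_degrees_eq_twice_card_edges, Set.ncard_eq_toFinset_card']
  have h2 : ∀ v, M.spanningCoe.degree v = if v ∈ M.verts.toFinset then 1 else 0 := by
    intro v
    rw [Subgraph.degree_spanningCoe]
    split_ifs with hv
    · exact h v (by simpa using hv)
    · exact Subgraph.degree_of_notMem_verts (by simpa using hv)
  simp [h2]

lemma isMaximumMatching_iff_verts [Finite V] :
    IsMaximumMatching G M ↔ M.IsMatching ∧
      ∀ M' : G.Subgraph, M'.IsMatching → M'.verts.ncard ≤ M.verts.ncard := by
  refine and_congr_right fun hM => forall₂_congr fun M' hM' => ?_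
  rw [← two_mul_ncard_edgeSet hM, ← two_mul_ncard_edgeSet hM']
  omega

/-- A set `X` that no edge of `M` leaves can be re-matched by any matching inside `X`. -/
lemma exists_isMatching_replace {M₂ : G.Subgraph} (hM : M.IsMatching) {X : Set V}
    (hX : ∀ x ∈ X, ∀ y, M.Adj x y → y ∈ X) (hM₂ : M₂.IsMatching) (h : M₂.verts ⊆ X) :
    ∃ M' : G.Subgraph, M'.IsMatching ∧ M'.verts = (M.verts \ X) ∪ M₂.verts ∧
      ∀ x y, M'.Adj x y ↔ (x ∉ X ∧ M.Adj x y) ∨ M₂.Adj x y := by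
  have key : ∀ x y, (M.deleteVerts X).Adj x y ↔ x ∉ X ∧ M.Adj x y := by
    intro x y
    rw [Subgraph.deleteVerts_adj]
    constructor
    · rintro ⟨-, hx, -, -, hxy⟩
      exact ⟨hx, hxy⟩
    · rintro ⟨hx, hxy⟩
      exact ⟨hxy.fst_mem, hx, hxy.snd_mem, fun hy => hx (hX y hy x hxy.symm), hxy⟩
  have hdel : (M.deleteVerts X).IsMatching := by
    rintro x ⟨hx, hxX⟩
    obtain ⟨y, hy, hu⟩ := hM hx
    exact ⟨y, (key x y).2 ⟨hxX, hy⟩, fun z hz => hu z ((key x z).1 hz).2⟩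
  refine ⟨M.deleteVerts X ⊔ M₂, hdel.sup hM₂ ?_, by simp, fun x y => ?_⟩
  · rw [hdel.support_eq_verts, hM₂.support_eq_verts, Set.disjoint_left]
    rintro x ⟨-, hx⟩ hx₂
    exact hx (h hx₂)
  · rw [Subgraph.sup_adj, key]

lemma IsMaximumMatching.mem_or_mem_of_adj [Finite V] (hM : IsMaximumMatching G M) {x y : V}
    (hxy : G.Adj x y) : x ∈ M.verts ∨ y ∈ M.verts := by
  by_contra! hc
  obtain ⟨hx, hy⟩ := hc
  rw [isMaximumMatching_iff_verts] at hM
  obtain ⟨M', hM', hv, -⟩ := exists_isMatching_replace hM.1 (X := {x, y})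
    (by rintro z (rfl | rfl) w hw
        · exact absurd hw.fst_mem hx
        · exact absurd hw.fst_mem hy)
    (Subgraph.IsMatching.subgraphOfAdj hxy) (by simp)
  have hlt : M.verts.ncard < M'.verts.ncard := by
    refine Set.ncard_lt_ncard ⟨?_, fun hle => hx (hle (by simp [hv]))⟩
    intro z hz
    rw [hv]
    refine Or.inl ⟨hz, ?_⟩
    rintro (rfl | rfl)
    · exact hx hz
    · exact hy hz
  exact absurd (hM.2 M' hM') (by omega)

/-- The matching edge `aw` can be traded for an edge from `a` to an unsaturated vertex `v`. -/
lemma IsMaximumMatching.exists_exchange [Finite V] (hM : IsMaximumMatching G M) {a w v : V}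
    (haw : M.Adj a w) (hv : v ∉ M.verts) (hav : G.Adj a v) :
    ∃ M' : G.Subgraph, IsMaximumMatching G M' ∧ M'.verts = insert v (M.verts \ {w}) ∧
      M'.Adj a v ∧ ∀ x y, x ≠ a → x ≠ w → x ≠ v → (M'.Adj x y ↔ M.Adj x y) := by
  rw [isMaximumMatching_iff_verts] at hM
  obtain ⟨hM, hmax⟩ := hM
  have hvw : v ≠ w := fun h => hv (h ▸ haw.snd_mem)
  have hwa : w ≠ a := haw.ne.symm
  obtain ⟨M', hM', hverts, hadj⟩ := exists_isMatching_replace hM (X := {a, w, v})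
    (by rintro z (rfl | rfl | rfl) u hu
        · simp [hM.eq_of_adj_left hu haw]
        · simp [hM.eq_of_adj_left hu haw.symm]
        · exact absurd hu.fst_mem hv)
    (Subgraph.IsMatching.subgraphOfAdj hav) (by intro z; simp; tauto)
  have hverts' : M'.verts = insert v (M.verts \ {w}) := by
    rw [hverts]
    ext z
    have := haw.fst_mem
    simp only [Set.mem_union, Set.mem_sdiff, Set.mem_insert_iff, Set.mem_singleton_iff,
      subgraphOfAdj_verts]
    grind
  refine ⟨M', isMaximumMatching_iff_verts.2 ⟨hM', fun K hK => (hmax K hK).trans ?_⟩, hverts',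
    (hadj _ _).2 (Or.inr (by simp)), fun x y hxa hxw hxv => ?_⟩
  · rw [hverts', Set.ncard_insert_of_notMem (fun h => hv h.1),
      Set.ncard_sdiff_singleton_add_one haw.snd_mem]
  · rw [hadj]
    simp [hxa, hxw, hxv]
    grind

/-- The vertices missed by some maximum matching. -/
def inessential (G : SimpleGraph V) : Set V :=
  {v | ∃ N : G.Subgraph, IsMaximumMatching G N ∧ v ∉ N.verts}

/-- `p` is an alternating path of even length for the maximum matching `M`, leading from `v` to an
unsaturated vertex, and switching `M` along `p` results in the maximum matching `M'`, which
misses `v`. The edges of `p` outside `M` belong to the matching `N`, and `p` avoids the edges that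
`M` and `N` have in common. -/
structure IsSwitch (M N M' : G.Subgraph) {v r : V} (p : G.Walk v r) : Prop where
  isPath : p.IsPath
  even_length : Even p.length
  isAlternating : IsAlternating M p
  head_mem : ∀ e ∈ p.edges.head?, e ∈ M.edgeSet
  end_notMem : r ∉ M.verts
  start_mem : v ∈ insert r M.verts
  darts : ∀ d ∈ p.darts, (M.Adj d.fst d.snd ∧ d.fst ∈ inessential G) ∨ N.Adj d.fst d.snd
  support : ∀ x ∈ p.support, x ∈ inessential G ∨ ∃ y ∈ inessential G, M.Adj x y
  common : ∀ x y, M.Adj x y → N.Adj x y → x ∉ p.support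
  isMaximum : IsMaximumMatching G M'
  start_notMem : v ∉ M'.verts
  verts_subset : M'.verts ⊆ insert r M.verts
  adj_iff : ∀ x ∉ p.support, ∀ y, M'.Adj x y ↔ M.Adj x y

/-- A vertex `v` missed by a maximum matching `N` is missed by a matching that arises from `M` by
switching along an alternating path from `v`. The path follows the symmetric difference of `M`
and `N`: its first two edges are the edge `va` of `M` and the edge `aw` of `N`, and it continues
from `w`, which is missed by the maximum matching obtained from `N` by trading `aw` for `av`. -/
theorem IsMaximumMatching.exists_isSwitch [Finite V] (hM : IsMaximumMatching G M)
    (hN : IsMaximumMatching G N) {v : V} (hv : v ∉ N.verts) :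
    ∃ (r : V) (p : G.Walk v r) (M' : G.Subgraph), IsSwitch M N M' p := by
  induction hn : (M.edgeSet \ N.edgeSet).ncard using Nat.strong_induction_on generalizing N v with
  | _ n ih =>
  have hvD : v ∈ inessential G := ⟨N, hN, hv⟩
  by_cases hvM : v ∈ M.verts
  swap
  · refine ⟨v, .nil, M, ⟨by simp, by simp, by simp [IsAlternating], by simp, hvM, by simp, by simp,
      by simpa using Or.inl hvD, ?_, hM, hvM, by simp, by simp⟩⟩
    intro x y _ hN hx
    obtain rfl : x = v := by simpa using hx
    exact hv hN.fst_mem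
  obtain ⟨a, hva, -⟩ := hM.1 hvM
  have haN : a ∈ N.verts := (hN.mem_or_mem_of_adj hva.adj_sub).resolve_left hv
  obtain ⟨w, haw, -⟩ := hN.1 haN
  have hwv : w ≠ v := fun h => hv (h ▸ haw.snd_mem)
  have hawM : ¬ M.Adj a w := fun h => hwv (hM.1.eq_of_adj_left h hva.symm)
  obtain ⟨N', hN', hverts, hav', hadj⟩ := hN.exists_exchange haw hv hva.adj_sub.symm
  have hwN' : w ∉ N'.verts := by simp [hverts, hwv]
  have hNN' : ∀ x y, M.Adj x y → N.Adj x y → N'.Adj x y := by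
    intro x y hx hy
    by_cases hxa : x = a
    · subst hxa
      exact absurd (hN.1.eq_of_adj_left hy haw ▸ hx) hawM
    by_cases hxw : x = w
    · subst hxw
      exact absurd ((hN.1.eq_of_adj_left hy haw.symm ▸ hx).symm) hawM
    by_cases hxv : x = v
    · subst hxv
      exact absurd hy.fst_mem hv
    exact (hadj x y hxa hxw hxv).2 hy
  have hlt : (M.edgeSet \ N'.edgeSet).ncard < n := by
    rw [← hn]
    refine Set.ncard_lt_ncard ⟨?_, fun hle => ?_⟩
    · intro e
      induction e with | _ x y =>
      rintro ⟨h1, h2⟩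
      exact ⟨h1, fun h3 => h2 (hNN' x y h1 h3)⟩
    · have : s(v, a) ∈ M.edgeSet \ N.edgeSet := ⟨hva, fun h => hv (Subgraph.Adj.fst_mem h)⟩
      exact (hle this).2 hav'.symm
  obtain ⟨r, q, M₁, hq⟩ := ih _ hlt hN' hwN' rfl
  have hvq : v ∉ q.support := hq.common v a hva hav'.symm
  have haq : a ∉ q.support := hq.common a v hva.symm hav'
  have hva₁ : M₁.Adj v a := (hq.adj_iff v hvq a).2 hva
  obtain ⟨M', hM', hverts', -, hadj'⟩ :=
    hq.isMaximum.exists_exchange hva₁.symm hq.start_notMem haw.adj_sub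
  refine ⟨r, .cons hva.adj_sub (.cons haw.adj_sub q), M', ?_, ?_, ?_, ?_, hq.end_notMem,
    by simp [hvM], ?_, ?_, ?_, hM', ?_, ?_, ?_⟩
  · simp [hq.isPath, hvq, haq, hva.ne]
  · simpa [Nat.even_add_one] using hq.even_length
  · have h1 : (s(v, a) : Sym2 V) ∈ M.edgeSet := hva
    have h2 : (s(a, w) : Sym2 V) ∉ M.edgeSet := hawM
    simp only [IsAlternating, Walk.edges_cons, List.isChain_cons_cons]
    refine ⟨by simp [h1, h2], ?_⟩
    rw [List.isChain_cons]
    exact ⟨fun e he => by simp [h2, hq.head_mem e he], hq.isAlternating⟩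
  · simpa using hva
  · intro d hd
    simp only [Walk.darts_cons, List.mem_cons] at hd
    rcases hd with rfl | rfl | hd
    · exact Or.inl ⟨hva, hvD⟩
    · exact Or.inr haw
    · refine (hq.darts d hd).imp_right fun h => ?_
      have h1 : d.fst ∈ q.support := q.dart_fst_mem_support_of_mem_darts hd
      by_cases hw : d.fst = w
      · exact absurd (hw ▸ h.fst_mem) hwN'
      · exact (hadj _ _ (fun h => haq (h ▸ h1)) hw (fun h => hvq (h ▸ h1))).1 h
  · intro x hx
    simp only [Walk.support_cons, List.mem_cons] at hx
    rcases hx with rfl | rfl | hx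
    · exact Or.inl hvD
    · exact Or.inr ⟨v, hvD, hva.symm⟩
    · exact hq.support x hx
  · intro x y hx hy
    simp only [Walk.support_cons, List.mem_cons, not_or]
    refine ⟨fun h => hv (h ▸ hy.fst_mem), ?_, hq.common x y hx (hNN' x y hx hy)⟩
    rintro rfl
    exact hawM (hN.1.eq_of_adj_left hy haw ▸ hx)
  · simp [hverts', hwv.symm]
  · rw [hverts']
    rintro x (rfl | hx)
    · exact hq.start_mem
    · exact hq.verts_subset hx.1
  · intro x hx y
    simp only [Walk.support_cons, List.mem_cons, not_or] at hx
    rw [hadj' x y hx.2.1 hx.1, hq.adj_iff x hx.2.2]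
    rintro rfl
    exact hx.2.2 q.start_mem_support

end Matchings

/-! ### Odd cycles -/

section OddCycles

variable {V : Type*} {G : SimpleGraph V} {M N C : G.Subgraph}

lemma IsOddCycle.exists_walk (hC : IsOddCycle G C) {d : V} (hd : d ∈ C.verts) :
    ∃ p : G.Walk d d, p.IsCycle ∧ Odd p.length ∧ C = p.toSubgraph := by
  classical
  obtain ⟨u, p, hp, hodd, rfl⟩ := hC
  have hd' : d ∈ p.support := p.mem_verts_toSubgraph.1 hd
  exact ⟨p.rotate d hd', hp.rotate hd', by simpa using hodd, by simp⟩

lemma IsOddCycle.ncard_edgeSet (hC : IsOddCycle G C) :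
    C.edgeSet.ncard = C.verts.ncard := by
  classical
  obtain ⟨u, p, hp, -, rfl⟩ := hC
  have h1 : p.toSubgraph.edgeSet = (p.edges.toFinset : Set (Sym2 V)) := by
    ext e; simp
  have h2 : p.toSubgraph.verts = (p.support.tail.toFinset : Set V) := by
    ext x
    rw [Walk.mem_verts_toSubgraph, List.coe_toFinset, Set.mem_ofPred_eq, Walk.mem_support_iff]
    refine ⟨?_, Or.inr⟩
    rintro (rfl | h)
    · exact p.end_mem_tail_support hp.not_nil
    · exact h
  rw [h1, h2, Set.ncard_coe_finset, Set.ncard_coe_finset,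
    List.toFinset_card_of_nodup hp.edges_nodup, List.toFinset_card_of_nodup hp.support_nodup]
  simp

lemma IsOddCycle.exists_adj (hC : IsOddCycle G C) {d : V} (hd : d ∈ C.verts) :
    ∃ e, C.Adj d e := by
  obtain ⟨p, hp, -, rfl⟩ := hC.exists_walk hd
  cases p with
  | nil => exact absurd rfl hp.ne_nil
  | @cons _ a _ h q => exact ⟨a, Or.inl (by simp)⟩

lemma exists_isMatching_of_isPath : ∀ {u v : V} (p : G.Walk u v), p.IsPath → Odd p.length →
    ∃ K : G.Subgraph, K.IsMatching ∧ K.verts = {x | x ∈ p.support} ∧ K ≤ p.toSubgraph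
  | _, _, .nil, _, h => by simp at h
  | u, v, .cons h .nil, _, _ => by
    refine ⟨G.subgraphOfAdj h, .subgraphOfAdj h, ?_, by simp⟩
    ext x; simp
  | u, v, .cons (v := a) h (.cons (v := b) h' q), hp, hodd => by
    rw [Walk.cons_isPath_iff, Walk.cons_isPath_iff] at hp
    obtain ⟨K, hK, hv, hle⟩ := exists_isMatching_of_isPath q hp.1.1
      (by simpa [Nat.odd_add_one] using hodd)
    have hu : u ∉ q.support := fun hu => hp.2 (by simp [hu])
    refine ⟨G.subgraphOfAdj h ⊔ K, (Subgraph.IsMatching.subgraphOfAdj h).sup hK ?_, ?_, ?_⟩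
    · rw [hK.support_eq_verts, (Subgraph.IsMatching.subgraphOfAdj h).support_eq_verts, hv,
        Set.disjoint_left]
      rintro x (rfl | rfl) hx
      · exact hu hx
      · exact hp.1.2 hx
    · ext x
      simp [hv, or_assoc]
    · exact sup_le_sup le_rfl (hle.trans le_sup_right)

/-- Deleting a vertex of an odd cycle leaves a path with a perfect matching. -/
lemma IsOddCycle.exists_isMatching (hC : IsOddCycle G C) {d : V} (hd : d ∈ C.verts) :
    ∃ K : G.Subgraph, K.IsMatching ∧ K.verts = C.verts \ {d} ∧ K ≤ C := by
  obtain ⟨p, hp, hodd, rfl⟩ := hC.exists_walk hd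
  cases p with
  | nil => exact absurd rfl hp.ne_nil
  | cons h q =>
    rw [Walk.cons_isCycle_iff] at hp
    have hq : ¬ q.reverse.Nil := by
      intro h'
      have := h'.eq
      exact h.ne this
    have hpath := hp.1.reverse
    have hlen : q.reverse.length = q.length := by simp
    have hsup : ∀ x, x ∈ q.reverse.support ↔ x ∈ q.support := by simp
    have hsub : q.reverse.toSubgraph = q.toSubgraph := by simp
    generalize q.reverse = q' at *
    cases q' with
    | nil => simp at hq
    | cons h' s =>
      rw [Walk.cons_isPath_iff] at hpath
      obtain ⟨K, hK, hv, hle⟩ := exists_isMatching_of_isPath s hpath.1 (by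
        simp only [Walk.length_cons, ← hlen] at hodd
        simpa [Nat.odd_add_one] using hodd)
      refine ⟨K, hK, ?_, ?_⟩
      · ext x
        rw [hv]
        simp only [Set.mem_ofPred_eq, Set.mem_sdiff, Walk.mem_verts_toSubgraph, Walk.support_cons,
          List.mem_cons, Set.mem_singleton_iff, ← hsup]
        constructor
        · intro hx
          exact ⟨by simp [hx], fun h => hpath.2 (h ▸ hx)⟩
        · tauto
      · refine hle.trans (le_trans ?_ le_sup_right)
        rw [← hsub]
        exact le_sup_right

/-- If maximum matchings `M` and `N` miss the ends `y` and `x` of an edge, then the alternating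
path of even length that starts in `x` has to end in `y`, since otherwise a maximum matching misses
both ends. With the edge, it forms an odd cycle. -/
theorem exists_isOddCycle_of_adj [Finite V] {x y : V} (hx : x ∈ inessential G)
    (hy : y ∈ inessential G) (hxy : G.Adj x y) : ∃ C, IsOddCycle G C ∧ C.Adj x y := by
  obtain ⟨N, hN, hxN⟩ := hx
  obtain ⟨M, hM, hyM⟩ := hy
  obtain ⟨r, p, M', hp⟩ := hM.exists_isSwitch hN hxN
  obtain rfl : r = y := by
    by_contra hne
    rcases hp.isMaximum.mem_or_mem_of_adj hxy with h | h
    · exact hp.start_notMem h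
    · rcases hp.verts_subset h with rfl | h
      · exact hne rfl
      · exact hyM h
  refine ⟨_, ⟨r, .cons hxy.symm p, ?_, ?_, rfl⟩, by simp⟩
  · refine (Walk.cons_isCycle_iff _ _).2 ⟨hp.isPath, fun he => ?_⟩
    obtain ⟨d, hd, hde⟩ := List.mem_map.1 he
    have : s(r, x) ∈ M.edgeSet ∨ s(r, x) ∈ N.edgeSet := by
      rw [← hde]
      exact (hp.darts d hd).imp And.left id
    rcases this with h | h
    · exact hyM (Subgraph.Adj.fst_mem h)
    · exact hxN (Subgraph.Adj.snd_mem h)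
  · simpa [Nat.odd_add_one] using hp.even_length

/-- The edges of `M` in `C` form a matching, which saturates twice as many vertices. -/
lemma ncard_saturated_inter [Finite V] (hM : M.IsMatching) (C : G.Subgraph) :
    {x | ∃ y, C.Adj x y ∧ M.Adj x y}.ncard = 2 * (C.edgeSet ∩ M.edgeSet).ncard := by
  let K : G.Subgraph :=
    { verts := {x | ∃ y, C.Adj x y ∧ M.Adj x y}
      Adj := fun x y => C.Adj x y ∧ M.Adj x y
      adj_sub := fun h => h.1.adj_sub
      edge_vert := fun h => ⟨_, h⟩
      symm := ⟨fun _ _ h => ⟨h.1.symm, h.2.symm⟩⟩ }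
  have hK : K.IsMatching := by
    rintro x ⟨y, h⟩
    exact ⟨y, h, fun z hz => hM.eq_of_adj_left hz.2 h.2⟩
  have hE : K.edgeSet = C.edgeSet ∩ M.edgeSet := by
    ext e
    induction e with | _ x y => rfl
  rw [← hE, two_mul_ncard_edgeSet hK]

/-- Switching a maximum matching along an alternating path of even length to an unsaturated
vertex, such as the stem of a flower. -/
lemma IsMaximumMatching.exists_of_isAlternating [Finite V] (hM : IsMaximumMatching G M) :
    ∀ {b r : V} (p : G.Walk b r), p.IsPath → Even p.length → IsAlternating M p → r ∉ M.verts →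
      (∀ e ∈ p.edges.head?, e ∈ M.edgeSet) ∧ ∃ N : G.Subgraph, IsMaximumMatching G N ∧
        b ∉ N.verts ∧ ∀ x ∉ p.support, ∀ y, N.Adj x y ↔ M.Adj x y
  | _, _, .nil, _, _, _, hr => ⟨by simp, M, hM, hr, by simp⟩
  | _, _, .cons _ .nil, _, h, _, _ => by simp at h
  | b, r, .cons (v := a) h (.cons (v := w) h' q), hp, heven, halt, hr => by
    rw [Walk.cons_isPath_iff, Walk.cons_isPath_iff] at hp
    simp only [IsAlternating, Walk.edges_cons, List.isChain_cons_cons] at halt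
    rw [List.isChain_cons] at halt
    obtain ⟨hhead, N, hN, hw, hadj⟩ := hM.exists_of_isAlternating q hp.1.1
      (by simpa [Nat.even_add_one] using heven) halt.2.2 hr
    have hawM : s(a, w) ∉ M.edgeSet := by
      intro haw
      cases q with
      | nil => exact hr (Subgraph.Adj.snd_mem haw)
      | cons h'' q => exact (halt.2.1 _ rfl).1 haw (hhead _ rfl)
    have hba : M.Adj b a := halt.1.2 hawM
    have hbq : b ∉ q.support := fun h => hp.2 (by simp [h])
    obtain ⟨N', hN', hverts, -, hadj'⟩ :=
      hN.exists_exchange ((hadj b hbq a).2 hba).symm hw h'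
    refine ⟨by simpa using hba, N', hN', ?_, fun x hx y => ?_⟩
    · rw [hverts]
      rintro (rfl | h)
      · exact hbq q.start_mem_support
      · exact h.2 rfl
    · simp only [Walk.support_cons, List.mem_cons, not_or] at hx
      rw [hadj' x y hx.2.1 hx.1, hadj x hx.2.2]
      rintro rfl
      exact hx.2.2 q.start_mem_support

lemma verts_subset_reach (hC : (reach C).Nonempty) : C.verts ⊆ reach C := by
  obtain ⟨-, M, F, hM, hF, -⟩ := hC
  obtain ⟨hB, b, r, p, hp, rfl⟩ := hF
  exact fun x hx => ⟨M, _, hM, ⟨hB, b, r, p, hp, rfl⟩, Or.inl hx⟩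

/-- If some flower has blossom `C`, then every vertex `d` of `C` is missed by a maximum matching
no edge of which leaves `C`: switch along the stem and rotate the blossom. -/
lemma IsOddCycle.exists_isMaximumMatching [Finite V] (hC : IsOddCycle G C)
    (hR : (reach C).Nonempty) {d : V} (hd : d ∈ C.verts) :
    ∃ N : G.Subgraph, IsMaximumMatching G N ∧ d ∉ N.verts ∧
      ∀ x ∈ C.verts, ∀ y, N.Adj x y → y ∈ C.verts := by
  obtain ⟨-, M, F, hM, ⟨⟨-, hB⟩, b, r, p, hp, -⟩, -⟩ := hR
  obtain ⟨-, N, hN, hb, hadj⟩ := hM.exists_of_isAlternating p hp.isPath hp.even_length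
    hp.isAlternating hp.root_unsaturated
  have hsat : {x | ∃ y, C.Adj x y ∧ M.Adj x y} = C.verts \ {b} := by
    refine Set.eq_of_subset_of_ncard_le ?_ ?_
    · rintro x ⟨y, hy, hy'⟩
      refine ⟨hy.fst_mem, ?_⟩
      rintro rfl
      exact hp.isBase.2 y hy hy'
    · rw [ncard_saturated_inter hM.1, Set.ncard_sdiff_singleton_of_mem hp.isBase.1,
        ← hC.ncard_edgeSet, hB]
      simp
  have hmate : ∀ x ∈ C.verts, x ≠ b → ∃ y ∈ C.verts, N.Adj x y := by
    intro x hx hxb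
    obtain ⟨y, hy, hy'⟩ : x ∈ {x | ∃ y, C.Adj x y ∧ M.Adj x y} := hsat ▸ ⟨hx, hxb⟩
    exact ⟨y, hy.snd_mem, (hadj x (fun h => hxb (hp.inter_eq x h hx)) y).2 hy'⟩
  have hclosed : ∀ x ∈ C.verts, ∀ y, N.Adj x y → y ∈ C.verts := by
    intro x hx y hxy
    have hxb : x ≠ b := fun h => hb (h ▸ hxy.fst_mem)
    obtain ⟨z, hz, hxz⟩ := hmate x hx hxb
    exact hN.1.eq_of_adj_left hxy hxz ▸ hz
  obtain ⟨K, hK, hKv, hKC⟩ := hC.exists_isMatching hd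
  rw [isMaximumMatching_iff_verts] at hN
  obtain ⟨N', hN', hv', hadj'⟩ := exists_isMatching_replace hN.1 hclosed hK
    (hKv ▸ Set.sdiff_subset)
  refine ⟨N', isMaximumMatching_iff_verts.2 ⟨hN', fun L hL => (hN.2 L hL).trans ?_⟩, ?_, ?_⟩
  · have h1 : N.verts = (N.verts \ C.verts) ∪ (C.verts \ {b}) := by
      ext x
      by_cases hx : x ∈ C.verts
      · by_cases hxb : x = b
        · simp [hxb, hb, hp.isBase.1]
        · obtain ⟨y, -, hy⟩ := hmate x hx hxb
          simp [hx, hxb, hy.fst_mem]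
      · simp [hx]
    have h2 : ∀ e, Disjoint (N.verts \ C.verts) (C.verts \ {e}) := fun e =>
      Set.disjoint_left.2 fun x h h' => h.2 h'.1
    rw [h1, hv', hKv, Set.ncard_union_eq (h2 _), Set.ncard_union_eq (h2 _),
      Set.ncard_sdiff_singleton_of_mem hd, Set.ncard_sdiff_singleton_of_mem hp.isBase.1]
  · simp [hv', hKv, hd]
  · intro x hx y hxy
    rcases (hadj' x y).1 hxy with h | h
    · exact absurd hx h.1
    · exact (hKC.2 h).snd_mem

end OddCycles

/-! ### The matching structure of an `R`-disjoint graph -/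

section Structure

variable {V : Type*} {G : SimpleGraph V} {M N C C' : G.Subgraph}

lemma IsRDisjoint.eq_of_mem_reach (hG : IsRDisjoint G) (hC : IsOddCycle G C)
    (hC' : IsOddCycle G C') {x : V} (hx : x ∈ reach C) (hx' : x ∈ C'.verts) : C = C' := by
  by_contra hne
  exact Set.disjoint_left.1 (hG.reach_disjoint C C' hC hC' hne) hx
    (verts_subset_reach (hG.reach_nonempty C' hC') hx')

lemma IsRDisjoint.eq_of_mem (hG : IsRDisjoint G) (hC : IsOddCycle G C)
    (hC' : IsOddCycle G C') {x : V} (hx : x ∈ C.verts) (hx' : x ∈ C'.verts) : C = C' :=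
  hG.eq_of_mem_reach hC hC' (verts_subset_reach (hG.reach_nonempty C hC) hx) hx'

lemma notMem_support_of_darts {S : Set V} : ∀ {u v : V} (p : G.Walk u v), u ∉ S →
    (∀ d ∈ p.darts, d.fst ∉ S → d.snd ∉ S) → ∀ x ∈ p.support, x ∉ S
  | _, _, .nil, hu, _ => by simpa using hu
  | u, v, .cons (v := a) h q, hu, hd => by
    intro x hx
    rw [Walk.support_cons, List.mem_cons] at hx
    rcases hx with rfl | hx
    · exact hu
    · exact notMem_support_of_darts q (hd ⟨(u, a), h⟩ (by simp) hu) (fun d hd' => hd d (by simp [hd'])) x hx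

variable [Finite V]

lemma IsRDisjoint.verts_subset_inessential (hG : IsRDisjoint G) (hC : IsOddCycle G C) :
    C.verts ⊆ inessential G := fun _ hx =>
  let ⟨N, hN, hx, _⟩ := hC.exists_isMaximumMatching (hG.reach_nonempty C hC) hx
  ⟨N, hN, hx⟩

/-- Every odd cycle is an entire connected component of the subgraph induced by the inessential
vertices, and has no chords. -/
lemma IsRDisjoint.adj_of_mem_inessential (hG : IsRDisjoint G) (hC : IsOddCycle G C) {x y : V}
    (hx : x ∈ C.verts) (hy : y ∈ inessential G) (hxy : G.Adj x y) : C.Adj x y := by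
  obtain ⟨C', hC', hadj⟩ :=
    exists_isOddCycle_of_adj (hG.verts_subset_inessential hC hx) hy hxy
  rwa [hG.eq_of_mem hC hC' hx hadj.fst_mem]

/-- If a vertex `c` of an odd cycle `C` is not matched inside `C`, then some maximum matching
missing `c` arises by switching along an alternating path that meets `C` only in `c`. -/
lemma IsRDisjoint.exists_isSwitch (hG : IsRDisjoint G) (hC : IsOddCycle G C)
    (hM : IsMaximumMatching G M) {c : V} (hc : c ∈ C.verts)
    (hcM : ∀ y ∈ C.verts, ¬ M.Adj c y) :
    ∃ (r : V) (p : G.Walk c r) (N M' : G.Subgraph), IsSwitch M N M' p ∧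
      ∀ x ∈ p.support, x ∈ C.verts → x = c := by
  obtain ⟨N, hN, hcN, hclosed⟩ := hC.exists_isMaximumMatching (hG.reach_nonempty C hC) hc
  obtain ⟨r, p, M', hp⟩ := hM.exists_isSwitch hN hcN
  refine ⟨r, p, N, M', hp, ?_⟩
  have hdarts := hp.darts
  clear hp
  cases p with
  | nil => simp
  | @cons _ a _ h q =>
    have ha : a ∉ C.verts := fun ha =>
      (hdarts ⟨(c, a), h⟩ (by simp)).elim (fun h => hcM a ha h.1) (fun h => hcN h.fst_mem)
    -- The edges of `N` do not join `C` to other vertices, and an edge from an inessential vertex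
    -- into `C` starts in `C`.
    have := notMem_support_of_darts q ha fun d hd hfst hsnd =>
      (hdarts d (by simp [hd])).elim
        (fun h => hfst (hG.adj_of_mem_inessential hC hsnd h.2 d.adj.symm).snd_mem)
        (fun h => hfst (hclosed _ hsnd _ h.symm))
    intro x hx hxC
    rw [Walk.support_cons, List.mem_cons] at hx
    exact hx.resolve_right fun hx => this x hx hxC

/-- A maximum matching leaves at most one vertex of an odd cycle `C` unmatched inside `C`. If it
left two, then switching would make both of them unsaturated, and a matching of `C` that misses a
single vertex would be larger. -/
theorem IsRDisjoint.eq_of_not_adj (hG : IsRDisjoint G) (hC : IsOddCycle G C)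
    (hM : IsMaximumMatching G M) {x y : V} (hx : x ∈ C.verts) (hy : y ∈ C.verts)
    (hxM : ∀ z, C.Adj x z → ¬ M.Adj x z) (hyM : ∀ z, C.Adj y z → ¬ M.Adj y z) : x = y := by
  induction hn : {z | z ∈ C.verts ∧ ∃ w ∉ C.verts, M.Adj z w}.ncard
    using Nat.strong_induction_on generalizing M with
  | _ n ih =>
  by_cases hclosed : ∀ z ∈ C.verts, ∀ w, M.Adj z w → w ∈ C.verts
  · by_contra hne
    have hunsat : ∀ z ∈ C.verts, (∀ w, C.Adj z w → ¬ M.Adj z w) → z ∉ M.verts := by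
      intro z hz hzM hzv
      obtain ⟨w, hw, -⟩ := hM.1 hzv
      exact hzM w (hG.adj_of_mem_inessential hC hz
        (hG.verts_subset_inessential hC (hclosed z hz w hw)) hw.adj_sub) hw
    obtain ⟨K, hK, hKv, -⟩ := hC.exists_isMatching hx
    rw [isMaximumMatching_iff_verts] at hM
    obtain ⟨M', hM', hv, -⟩ :=
      exists_isMatching_replace hM.1 hclosed hK (hKv ▸ Set.sdiff_subset)
    have hlt : M.verts.ncard < M'.verts.ncard := by
      refine Set.ncard_lt_ncard ⟨fun z hz => ?_, fun hle => hunsat y hy hyM (hle ?_)⟩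
      · rw [hv, hKv]
        by_cases hzC : z ∈ C.verts
        · exact Or.inr ⟨hzC, fun h => hunsat x hx hxM (h ▸ hz)⟩
        · exact Or.inl ⟨hz, hzC⟩
      · rw [hv, hKv]
        exact Or.inr ⟨hy, fun h => hne h.symm⟩
    exact absurd (hM.2 M' hM') (by omega)
  · push Not at hclosed
    obtain ⟨c, hc, a, hca, ha⟩ := hclosed
    obtain ⟨r, p, N, M', hp, hpC⟩ := hG.exists_isSwitch hC hM hc
      fun z hz h => ha (hM.1.eq_of_adj_left hca h ▸ hz)
    have hsub : ∀ z ∈ C.verts, ∀ w, M'.Adj z w → M.Adj z w := by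
      intro z hz w hzw
      refine (hp.adj_iff z (fun h => ?_) w).1 hzw
      exact hp.start_notMem (hpC z h hz ▸ hzw.fst_mem)
    refine ih _ ?_ hp.isMaximum (fun z hz h => hxM z hz (hsub x hx z h))
      (fun z hz h => hyM z hz (hsub y hy z h)) rfl
    rw [← hn]
    refine Set.ncard_lt_ncard ⟨?_, fun hle => ?_⟩
    · rintro z ⟨hz, w, hw, hzw⟩
      exact ⟨hz, w, hw, hsub z hz w hzw⟩
    · obtain ⟨-, w, -, hw⟩ := hle ⟨hc, a, ha, hca⟩
      exact hp.start_notMem hw.fst_mem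

/-- Some maximum matching has no edge that leaves an odd cycle. A path along which an edge leaving
`C` is switched away is a stem of the blossom `C`, hence it avoids all other odd cycles. -/
theorem IsRDisjoint.exists_isMaximumMatching (hG : IsRDisjoint G) :
    ∃ M : G.Subgraph, IsMaximumMatching G M ∧
      ∀ C, IsOddCycle G C → ∀ x ∈ C.verts, ∀ y, M.Adj x y → y ∈ C.verts := by
  obtain ⟨C₀, hC₀⟩ := hG.exists_oddCycle
  obtain ⟨-, M₀, -, hM₀, -⟩ := hG.reach_nonempty C₀ hC₀
  induction hn : {x | ∃ C, IsOddCycle G C ∧ x ∈ C.verts ∧ ∃ y ∉ C.verts, M₀.Adj x y}.ncard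
    using Nat.strong_induction_on generalizing M₀ with
  | _ n ih =>
  by_cases hclosed : ∀ C, IsOddCycle G C → ∀ x ∈ C.verts, ∀ y, M₀.Adj x y → y ∈ C.verts
  · exact ⟨M₀, hM₀, hclosed⟩
  · push Not at hclosed
    obtain ⟨C, hC, c, hc, a, hca, ha⟩ := hclosed
    have hcM : ∀ z ∈ C.verts, ¬ M₀.Adj c z := fun z hz h =>
      ha (hM₀.1.eq_of_adj_left hca h ▸ hz)
    obtain ⟨r, p, N, M', hp, hpC⟩ := hG.exists_isSwitch hC hM₀ hc hcM
    have hbase : IsBase M₀ C c := ⟨hc, fun w hw => hcM w hw.snd_mem⟩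
    have hsat : {x | ∃ y, C.Adj x y ∧ M₀.Adj x y} = C.verts \ {c} := by
      ext x
      constructor
      · rintro ⟨y, hy, hy'⟩
        exact ⟨hy.fst_mem, fun h => hbase.2 y (h ▸ hy) (h ▸ hy')⟩
      · rintro ⟨hx, hxc⟩
        by_contra hno
        refine hxc (hG.eq_of_not_adj hC hM₀ hx hc (fun z hz hz' => hno ⟨z, hz, hz'⟩) hbase.2)
    have hblossom : IsBlossom M₀ C := by
      refine ⟨hC, ?_⟩
      rw [← ncard_saturated_inter hM₀.1, hsat, Set.ncard_sdiff_singleton_add_one hc,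
        hC.ncard_edgeSet]
    have hreach : ∀ x ∈ p.support, x ∈ reach C := fun x hx =>
      ⟨M₀, _, hM₀, ⟨hblossom, c, r, p, ⟨hbase, hp.isPath, hp.even_length, hp.isAlternating,
        hp.end_notMem, hpC⟩, rfl⟩, Or.inr (p.mem_verts_toSubgraph.2 hx)⟩
    have hsub : ∀ C', IsOddCycle G C' → ∀ z ∈ C'.verts, ∀ w, M'.Adj z w → M₀.Adj z w := by
      intro C' hC' z hz w hzw
      refine (hp.adj_iff z (fun h => ?_) w).1 hzw
      obtain rfl := hG.eq_of_mem_reach hC hC' (hreach z h) hz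
      exact hp.start_notMem (hpC z h hz ▸ hzw.fst_mem)
    refine ih _ ?_ M' hp.isMaximum rfl
    rw [← hn]
    refine Set.ncard_lt_ncard ⟨?_, fun hle => ?_⟩
    · rintro z ⟨C', hC', hz, w, hw, hzw⟩
      exact ⟨C', hC', hz, w, hw, hsub C' hC' z hz w hzw⟩
    · obtain ⟨-, -, -, w, -, hw⟩ := hle ⟨C, hC, hc, a, ha, hca⟩
      exact hp.start_notMem hw.fst_mem

/-- A maximum matching matches every neighbour of an inessential vertex that is not itself
inessential to an inessential vertex. -/
theorem IsMaximumMatching.mem_inessential_of_adj (hM : IsMaximumMatching G M) {a b d : V}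
    (ha : a ∉ inessential G) (hd : d ∈ inessential G) (hda : G.Adj d a) (hab : M.Adj a b) :
    b ∈ inessential G := by
  obtain ⟨N, hN, hdN⟩ := hd
  obtain ⟨r, p, M', hp⟩ := hM.exists_isSwitch hN hdN
  by_cases hap : a ∈ p.support
  · obtain ⟨y, hy, hay⟩ := (hp.support a hap).resolve_left ha
    exact hM.1.eq_of_adj_left hab hay ▸ hy
  · have hab' := (hp.adj_iff a hap b).2 hab
    obtain ⟨L, hL, hv, -⟩ := hp.isMaximum.exists_exchange hab' hp.start_notMem hda.symm
    refine ⟨L, hL, ?_⟩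
    rw [hv]
    rintro (rfl | h)
    · exact hp.start_notMem hab'.snd_mem
    · exact h.2 rfl

end Structure

/-! ### Two-colourings away from the odd cycles -/

section Coloring

variable {V : Type*} {G : SimpleGraph V}

lemma exists_eq_append_of_not_isPath : ∀ {u v : V} (p : G.Walk u v), ¬ p.IsPath →
    ∃ (x : V) (p₁ : G.Walk u x) (c : G.Walk x x) (p₂ : G.Walk x v),
      p = p₁.append (c.append p₂) ∧ 0 < c.length
  | _, _, .nil, h => by simp at h
  | u, v, .cons h q, hp => by
    classical
    by_cases hu : u ∈ q.support
    · exact ⟨u, .nil, .cons h (q.takeUntil u hu), q.dropUntil u hu, by simp, by simp⟩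
    · obtain ⟨x, p₁, c, p₂, rfl, hc⟩ := exists_eq_append_of_not_isPath q fun hq =>
        hp ((Walk.cons_isPath_iff _ _).2 ⟨hq, hu⟩)
      exact ⟨x, .cons h p₁, c, p₂, by simp, hc⟩

lemma exists_isOddCycle_of_odd_length {u : V} (p : G.Walk u u) (hp : Odd p.length) :
    ∃ C : G.Subgraph, IsOddCycle G C ∧ ∀ x ∈ C.verts, x ∈ p.support := by
  induction hn : p.length using Nat.strong_induction_on generalizing u with
  | _ n ih =>
  cases p with
  | nil => simp at hp
  | @cons _ a _ h q =>
  by_cases hq : q.IsPath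
  · refine ⟨_, ⟨u, .cons h q, (Walk.cons_isCycle_iff _ _).2 ⟨hq, fun he => ?_⟩, hp, rfl⟩,
      fun x hx => (Walk.mem_verts_toSubgraph _).1 hx⟩
    -- A path that contains the edge joining its ends has length one.
    cases q with
    | nil => simp at he
    | @cons _ b _ h' q' =>
      rw [Walk.cons_isPath_iff] at hq
      rw [Walk.edges_cons, List.mem_cons] at he
      rcases he with he | he
      · have hb : u = b := by
          rcases Sym2.eq_iff.1 he with ⟨h1, -⟩ | ⟨h1, -⟩
          · exact absurd h1 h.ne
          · exact h1
        subst hb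
        have := Walk.length_eq_zero_iff.2 (Walk.isPath_iff_nil.1 hq.1)
        simp [this, Nat.odd_iff] at hp
      · exact hq.2 (q'.snd_mem_support_of_mem_edges he)
  · obtain ⟨x, p₁, c, p₂, rfl, hc⟩ := exists_eq_append_of_not_isPath q hq
    simp only [Walk.length_cons, Walk.length_append] at hn hp
    by_cases hodd : Odd c.length
    · obtain ⟨C, hC, hsub⟩ := ih c.length (by omega) c hodd rfl
      exact ⟨C, hC, fun y hy => by simp [Walk.mem_support_append_iff, hsub y hy]⟩
    · have hodd' : Odd (Walk.cons h (p₁.append p₂)).length := by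
        simp only [Walk.length_cons, Walk.length_append]
        grind
      obtain ⟨C, hC, hsub⟩ := ih (Walk.cons h (p₁.append p₂)).length
        (by simp only [Walk.length_cons, Walk.length_append]; omega) _ hodd' rfl
      refine ⟨C, hC, fun y hy => ?_⟩
      have := hsub y hy
      simp only [Walk.support_cons, List.mem_cons, Walk.mem_support_append_iff] at this ⊢
      tauto

/-- If every odd cycle meets `T`, then `G` is bipartite outside `T`. -/
lemma exists_coloring {T : Set V} (hT : ∀ C, IsOddCycle G C → ∃ x ∈ C.verts, x ∈ T) :
    ∃ χ : V → Fin 2, ∀ x ∉ T, ∀ y ∉ T, G.Adj x y → χ x ≠ χ y := by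
  classical
  have hcol : (G.induce Tᶜ).Colorable 2 := by
    rw [two_colorable_iff_forall_loop_even]
    intro u w
    by_contra hodd
    rw [Nat.not_even_iff_odd] at hodd
    obtain ⟨C, hC, hsub⟩ := exists_isOddCycle_of_odd_length
      (w.map (Embedding.induce Tᶜ).toHom) ((Walk.length_map _ _).symm ▸ hodd)
    obtain ⟨x, hx, hxT⟩ := hT C hC
    have := hsub x hx
    rw [Walk.support_map, List.mem_map] at this
    obtain ⟨⟨y, hy⟩, -, rfl⟩ := this
    exact hy hxT
  obtain ⟨χ⟩ := hcol
  refine ⟨fun x => if hx : x ∈ Tᶜ then χ ⟨x, hx⟩ else 0, fun x hx y hy hxy => ?_⟩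
  simp only [Set.mem_compl_iff, hx, hy, not_false_eq_true, dif_pos]
  exact χ.valid (by simpa using hxy)

end Coloring

/-! ### Counting along a matching -/

section Counting

variable {V : Type*} [Finite V] {G : SimpleGraph V} {K : G.Subgraph}

/-- Taking mates maps `A ∩ V(K)` injectively to `B ∩ V(K)`. -/
lemma ncard_inter_verts_le (hK : K.IsMatching) {A B : Set V}
    (h : ∀ x y, K.Adj x y → x ∈ A → y ∈ B) : (A ∩ K.verts).ncard ≤ (B ∩ K.verts).ncard := by
  choose! m hm using fun x (hx : x ∈ K.verts) => (hK hx).exists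
  refine Set.ncard_le_ncard_of_injOn m (fun x hx => ⟨h _ _ (hm x hx.2) hx.1, (hm x hx.2).snd_mem⟩)
    fun x hx y hy hxy => ?_
  exact hK.eq_of_adj_right (hm x hx.2) (hxy ▸ hm y hy.2)

variable {X T I : Set V}

lemma card_eq_of_verts_eq (hXT : Disjoint X T) (hv : K.verts = (X ∪ T)ᶜ) :
    Nat.card V = K.verts.ncard + X.ncard + T.ncard := by
  rw [← Set.ncard_add_ncard_compl K.verts, hv, compl_compl, Set.ncard_union_eq hXT, add_assoc]

lemma ncard_eq_of_disjoint (hv : K.verts = (X ∪ T)ᶜ) (hI : Disjoint I T) :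
    I.ncard = (I ∩ K.verts).ncard + (I ∩ X).ncard := by
  rw [← Set.ncard_inter_add_ncard_sdiff_eq_ncard I K.verts]
  congr 2
  ext x
  rw [Set.disjoint_left] at hI
  simp only [hv, Set.mem_sdiff, Set.mem_compl_iff, Set.mem_union, Set.mem_inter_iff]
  have := @hI x
  tauto

/-- An independent set that avoids `T` has at most one end of each edge of a matching that covers
everything but `X` and `T`. -/
lemma two_mul_ncard_add_le (hK : K.IsMatching) (hXT : Disjoint X T) (hv : K.verts = (X ∪ T)ᶜ)
    (hI : Disjoint I T) (hind : ∀ x y, K.Adj x y → x ∈ I → y ∉ I) :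
    2 * I.ncard + T.ncard ≤ Nat.card V + X.ncard := by
  have h1 := card_eq_of_verts_eq hXT hv
  have h2 := ncard_eq_of_disjoint hv hI
  have h3 : (I ∩ K.verts).ncard ≤ (Iᶜ ∩ K.verts).ncard := ncard_inter_verts_le hK hind
  have h4 := Set.ncard_inter_add_ncard_sdiff_eq_ncard K.verts I
  rw [Set.inter_comm, Set.sdiff_eq, Set.inter_comm K.verts] at h4
  have h5 : (I ∩ X).ncard ≤ X.ncard := Set.ncard_le_ncard Set.inter_subset_right
  omega

lemma two_mul_ncard_add_eq (hK : K.IsMatching) (hXT : Disjoint X T) (hv : K.verts = (X ∪ T)ᶜ)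
    (hI : Disjoint I T) (hind : ∀ x y, K.Adj x y → (x ∈ I ↔ y ∉ I)) (hX : X ⊆ I) :
    2 * I.ncard + T.ncard = Nat.card V + X.ncard := by
  have h1 := card_eq_of_verts_eq hXT hv
  have h2 := ncard_eq_of_disjoint hv hI
  have h3 : (I ∩ K.verts).ncard ≤ (Iᶜ ∩ K.verts).ncard :=
    ncard_inter_verts_le hK fun x y h => (hind x y h).1
  have h3' : (Iᶜ ∩ K.verts).ncard ≤ (I ∩ K.verts).ncard :=
    ncard_inter_verts_le hK fun x y h hx => not_not.1 fun hy => hx ((hind x y h).2 hy)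
  have h4 := Set.ncard_inter_add_ncard_sdiff_eq_ncard K.verts I
  rw [Set.inter_comm, Set.sdiff_eq, Set.inter_comm K.verts] at h4
  rw [Set.inter_eq_right.2 hX] at h2
  omega

lemma of_two_mul_ncard_add_eq (hK : K.IsMatching) (hXT : Disjoint X T)
    (hv : K.verts = (X ∪ T)ᶜ) (hI : Disjoint I T)
    (hind : ∀ x y, K.Adj x y → x ∈ I → y ∉ I)
    (heq : 2 * I.ncard + T.ncard = Nat.card V + X.ncard) :
    X ⊆ I ∧ ∀ x y, K.Adj x y → x ∈ I ∨ y ∈ I := by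
  have h1 := card_eq_of_verts_eq hXT hv
  have h2 := ncard_eq_of_disjoint hv hI
  have h3 : (I ∩ K.verts).ncard ≤ (Iᶜ ∩ K.verts).ncard := ncard_inter_verts_le hK hind
  have h4 := Set.ncard_inter_add_ncard_sdiff_eq_ncard K.verts I
  rw [Set.inter_comm, Set.sdiff_eq, Set.inter_comm K.verts] at h4
  have h5 : (I ∩ X).ncard ≤ X.ncard := Set.ncard_le_ncard Set.inter_subset_right
  constructor
  · refine Set.inter_eq_right.1 (Set.eq_of_subset_of_ncard_le Set.inter_subset_right ?_)
    omega
  · intro x y hxy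
    by_contra! hc
    -- The mates of the vertices in `I` and of `x` would lie outside `I`.
    have h6 : (insert x I ∩ K.verts).ncard ≤ (Iᶜ ∩ K.verts).ncard := by
      refine ncard_inter_verts_le hK ?_
      rintro a b hab (rfl | ha)
      · exact hK.eq_of_adj_left hxy hab ▸ hc.2
      · exact hind a b hab ha
    rw [Set.insert_inter_of_mem hxy.fst_mem,
      Set.ncard_insert_of_notMem (fun h => hc.1 h.1)] at h6
    omega

end Counting

/-! ### Maximum independent sets of an `R`-disjoint graph -/

section IndependentSets

variable {V : Type*} {G : SimpleGraph V} {M : G.Subgraph}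

/-- The vertices on odd cycles. -/
def oddVerts (G : SimpleGraph V) : Set V := {x | ∃ C : G.Subgraph, IsOddCycle G C ∧ x ∈ C.verts}

/-- The set of vertices that `t` selects from the odd cycles. -/
def selected (G : SimpleGraph V) (t : G.Subgraph → V) : Set V := t '' {C | IsOddCycle G C}

/-- The vertices missed by `M` that lie on no odd cycle. -/
def exposed (M : G.Subgraph) : Set V := (M.verts ∪ oddVerts G)ᶜ

lemma selected_subset {t : G.Subgraph → V} (ht : ∀ C, IsOddCycle G C → t C ∈ C.verts) :
    selected G t ⊆ oddVerts G := by
  rintro _ ⟨C, hC, rfl⟩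
  exact ⟨C, hC, ht C hC⟩

lemma disjoint_exposed_selected {t : G.Subgraph → V} (ht : ∀ C, IsOddCycle G C → t C ∈ C.verts) :
    Disjoint (exposed M) (selected G t) :=
  Set.disjoint_left.2 fun _ hx hx' => hx (Or.inr (selected_subset ht hx'))

lemma IsRDisjoint.ncard_selected (hG : IsRDisjoint G) {t : G.Subgraph → V}
    (ht : ∀ C, IsOddCycle G C → t C ∈ C.verts) :
    (selected G t).ncard = {C : G.Subgraph | IsOddCycle G C}.ncard :=
  Set.InjOn.ncard_image fun C hC C' hC' h => hG.eq_of_mem hC hC' (ht C hC) (h ▸ ht C' hC')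

/-- If no edge of `M` leaves an odd cycle, then any selection of one vertex from each odd cycle
belongs to a matching that agrees with `M` outside the odd cycles, and that misses the selected
vertices but no other vertex of an odd cycle. -/
lemma IsRDisjoint.exists_isMatching (hG : IsRDisjoint G) (hM : M.IsMatching)
    (hclosed : ∀ C, IsOddCycle G C → ∀ x ∈ C.verts, ∀ y, M.Adj x y → y ∈ C.verts)
    {t : G.Subgraph → V} (ht : ∀ C, IsOddCycle G C → t C ∈ C.verts) :
    ∃ K : G.Subgraph, K.IsMatching ∧ K.verts = (exposed M ∪ selected G t)ᶜ ∧
      (∀ x y, K.Adj x y → (x ∉ oddVerts G ∧ y ∉ oddVerts G ∧ M.Adj x y) ∨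
        (x ∈ oddVerts G ∧ y ∈ oddVerts G)) ∧
      ∀ x y, x ∉ oddVerts G → M.Adj x y → K.Adj x y := by
  choose F hF hFv _ using fun C : {C : G.Subgraph // IsOddCycle G C} =>
    C.2.exists_isMatching (ht C.1 C.2)
  have hU : ∀ x ∈ oddVerts G, ∀ y, M.Adj x y → y ∈ oddVerts G := by
    rintro x ⟨C, hC, hx⟩ y hxy
    exact ⟨C, hC, hclosed C hC x hx y hxy⟩
  have hverts : (⨆ C, F C).verts = oddVerts G \ selected G t := by
    ext x
    simp only [Subgraph.verts_iSup, Set.mem_iUnion, hFv]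
    constructor
    · rintro ⟨⟨C, hC⟩, hx, hxt⟩
      refine ⟨⟨C, hC, hx⟩, ?_⟩
      rintro ⟨C', hC', rfl⟩
      obtain rfl := hG.eq_of_mem hC hC' hx (ht C' hC')
      exact hxt rfl
    · rintro ⟨⟨C, hC, hx⟩, hxt⟩
      exact ⟨⟨C, hC⟩, hx, fun h => hxt ⟨C, hC, h.symm⟩⟩
  have hmatch : (⨆ C, F C).IsMatching := by
    refine Subgraph.IsMatching.iSup hF fun C C' hne => ?_
    change Disjoint (F C).support (F C').support
    rw [(hF C).support_eq_verts, (hF C').support_eq_verts, hFv, hFv, Set.disjoint_left]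
    exact fun x hx hx' => hne (Subtype.ext (hG.eq_of_mem C.2 C'.2 hx.1 hx'.1))
  obtain ⟨K, hK, hKv, hKadj⟩ := exists_isMatching_replace hM hU hmatch
    (hverts ▸ Set.sdiff_subset)
  refine ⟨K, hK, ?_, fun x y hxy => ?_, fun x y hx hxy => (hKadj x y).2 (Or.inl ⟨hx, hxy⟩)⟩
  · ext x
    have : x ∈ selected G t → x ∈ oddVerts G := fun h => selected_subset ht h
    simp only [hKv, hverts, exposed, Set.mem_union, Set.mem_sdiff, Set.mem_compl_iff]
    tauto
  · refine ((hKadj x y).1 hxy).imp (fun h => ⟨h.1, fun hy => h.1 (hU y hy x h.2.symm), h.2⟩)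
      fun h => ?_
    have h1 : x ∈ oddVerts G \ selected G t := hverts ▸ h.fst_mem
    have h2 : y ∈ oddVerts G \ selected G t := hverts ▸ h.snd_mem
    exact ⟨h1.1, h2.1⟩

/-- Every independent set misses a vertex of each odd cycle. -/
lemma IsRDisjoint.exists_selection (hG : IsRDisjoint G) {I : Set V} (hI : G.IsIndepSet I) :
    ∃ t : G.Subgraph → V, (∀ C, IsOddCycle G C → t C ∈ C.verts) ∧ Disjoint I (selected G t) := by
  have h : ∀ C : G.Subgraph, IsOddCycle G C → ∃ x ∈ C.verts, x ∉ I := by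
    intro C hC
    obtain ⟨u, p, hp, hodd, rfl⟩ := id hC
    obtain ⟨y, hy⟩ := hC.exists_adj p.start_mem_verts_toSubgraph
    by_cases hu : u ∈ I
    · exact ⟨y, hy.snd_mem, fun hy' => hI hu hy' hy.ne hy.adj_sub⟩
    · exact ⟨u, hy.fst_mem, hu⟩
  have hV : Nonempty V := hG.exists_oddCycle.elim fun _ hC => (h _ hC).nonempty
  choose! t ht htI using h
  refine ⟨t, ht, Set.disjoint_left.2 ?_⟩
  rintro _ hx ⟨C, hC, rfl⟩
  exact htI C hC hx

variable [Finite V]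

lemma IsRDisjoint.oddVerts_subset_inessential (hG : IsRDisjoint G) :
    oddVerts G ⊆ inessential G := by
  rintro x ⟨C, hC, hx⟩
  exact hG.verts_subset_inessential hC hx

lemma mem_oddVerts_of_adj {x y : V} (hx : x ∈ inessential G)
    (hy : y ∈ inessential G) (hxy : G.Adj x y) : x ∈ oddVerts G := by
  obtain ⟨C, hC, h⟩ := exists_isOddCycle_of_adj hx hy hxy
  exact ⟨C, hC, h.fst_mem⟩

/-- An independent set as large as the matching allows: the inessential vertices on no odd cycle,
and a colour class of the bipartite graph that remains when one deletes these, a vertex from each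
odd cycle, and the neighbours of inessential vertices that are not inessential themselves. -/
theorem IsRDisjoint.exists_isIndepSet (hG : IsRDisjoint G) (hM : IsMaximumMatching G M)
    (hclosed : ∀ C, IsOddCycle G C → ∀ x ∈ C.verts, ∀ y, M.Adj x y → y ∈ C.verts)
    {t : G.Subgraph → V} (ht : ∀ C, IsOddCycle G C → t C ∈ C.verts) {v : V}
    (hv : v ∈ oddVerts G) :
    ∃ S : Set V, G.IsIndepSet S ∧ Disjoint S (selected G t) ∧ (v ∉ selected G t → v ∈ S) ∧
      2 * S.ncard + (selected G t).ncard = Nat.card V + (exposed M).ncard := by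
  obtain ⟨χ, hχ⟩ := exists_coloring (G := G) (T := selected G t)
    fun C hC => ⟨t C, ht C hC, C, hC, rfl⟩
  have hUD := hG.oddVerts_subset_inessential
  have hTU := selected_subset ht
  obtain ⟨K, hK, hKv, hKadj, -⟩ := hG.exists_isMatching hM.1 hclosed ht
  -- The vertices to be coloured.
  set B : Set V := {x | (x ∈ inessential G → x ∈ oddVerts G) ∧ x ∉ selected G t ∧
    (x ∉ inessential G → ∀ d ∈ inessential G, ¬ G.Adj d x)} with hB
  have hUB : ∀ x ∈ oddVerts G, x ∉ selected G t → x ∈ B := fun x hx hxt =>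
    ⟨fun _ => hx, hxt, fun h => absurd (hUD hx) h⟩
  have hDB : ∀ x ∈ inessential G, x ∉ oddVerts G → ∀ y ∈ B, ¬ G.Adj x y := by
    intro x hx hxU y hy hxy
    by_cases hyD : y ∈ inessential G
    · exact hxU (mem_oddVerts_of_adj hx hyD hxy)
    · exact hy.2.2 hyD x hx hxy
  set S : Set V := {x | (x ∈ inessential G ∧ x ∉ oddVerts G) ∨ (x ∈ B ∧ χ x = χ v)} with hS
  have hST : Disjoint S (selected G t) := by
    rw [Set.disjoint_left]
    rintro x (⟨-, hxU⟩ | ⟨hx, -⟩) hxt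
    · exact hxU (hTU hxt)
    · exact hx.2.1 hxt
  refine ⟨S, ?_, hST, fun hvt => Or.inr ⟨hUB v hv hvt, rfl⟩,
    two_mul_ncard_add_eq hK (disjoint_exposed_selected ht) hKv hST ?_ ?_⟩
  · rintro x (⟨hx, hxU⟩ | ⟨hx, hxv⟩) y (⟨hy, hyU⟩ | ⟨hy, hyv⟩) - hxy
    · exact hxU (mem_oddVerts_of_adj hx hy hxy)
    · exact hDB x hx hxU y hy hxy
    · exact hDB y hy hyU x hx hxy.symm
    · exact hχ x hx.2.1 y hy.2.1 hxy (hxv.trans hyv.symm)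
  · intro x y hxy
    have hcol : x ∈ B → y ∈ B → (x ∈ S ↔ y ∉ S) := by
      intro hx hy
      have := hχ x hx.2.1 y hy.2.1 hxy.adj_sub
      have h1 : ¬ (x ∈ inessential G ∧ x ∉ oddVerts G) := fun h => h.2 (hx.1 h.1)
      have h2 : ¬ (y ∈ inessential G ∧ y ∉ oddVerts G) := fun h => h.2 (hy.1 h.1)
      simp only [hS, Set.mem_ofPred_eq, h1, h2, hx, hy, true_and, false_or]
      omega
    have hnot : ∀ z, z ∈ K.verts → z ∉ selected G t := by
      intro z hz
      rw [hKv] at hz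
      exact fun h => hz (Or.inr h)
    -- An edge of `M` outside the odd cycles with an inessential end has its other end in the
    -- neighbourhood of the inessential vertices, which `B` avoids.
    have hmix : ∀ x y, x ∈ inessential G → x ∉ oddVerts G → M.Adj x y →
        y ∉ inessential G ∧ y ∉ B := by
      intro x y hx hxU hxy
      have hy : y ∉ inessential G := fun hy => hxU (mem_oddVerts_of_adj hx hy hxy.adj_sub)
      exact ⟨hy, fun h => h.2.2 hy x hx hxy.adj_sub⟩
    rcases hKadj x y hxy with ⟨hxU, hyU, hxyM⟩ | ⟨hxU, hyU⟩
    · by_cases hxD : x ∈ inessential G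
      · obtain ⟨h1, h2⟩ := hmix x y hxD hxU hxyM
        simp [hS, hxD, hxU, h1, h2]
      · by_cases hyD : y ∈ inessential G
        · obtain ⟨h1, h2⟩ := hmix y x hyD hyU hxyM.symm
          simp [hS, hyD, hyU, h1, h2]
        · refine hcol ⟨fun h => absurd h hxD, hnot x hxy.fst_mem, fun _ d hd hdx => hyD ?_⟩
            ⟨fun h => absurd h hyD, hnot y hxy.snd_mem, fun _ d hd hdy => hxD ?_⟩
          · exact hM.mem_inessential_of_adj hxD hd hdx hxyM
          · exact hM.mem_inessential_of_adj hyD hd hdy hxyM.symm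
    · exact hcol (hUB x hxU (hnot x hxy.fst_mem)) (hUB y hyU (hnot y hxy.snd_mem))
  · intro x hx
    exact Or.inl ⟨⟨M, hM, fun h => hx (Or.inl h)⟩, fun h => hx (Or.inr h)⟩

end IndependentSets

/-! ### Corona and core -/

section CoronaCore

variable {V : Type*} [Finite V] {G : SimpleGraph V} {M : G.Subgraph}

/-- With `μ` edges in `M` and `k` odd cycles this says `α(G) = |V| - μ - k`, because `M` misses
`k` vertices on odd cycles. -/
theorem IsRDisjoint.two_mul_indepNum_add (hG : IsRDisjoint G) (hM : IsMaximumMatching G M)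
    (hclosed : ∀ C, IsOddCycle G C → ∀ x ∈ C.verts, ∀ y, M.Adj x y → y ∈ C.verts) :
    2 * G.indepNum + {C : G.Subgraph | IsOddCycle G C}.ncard =
      Nat.card V + (exposed M).ncard := by
  obtain ⟨C, hC⟩ := hG.exists_oddCycle
  obtain ⟨u, p, -, -, rfl⟩ := id hC
  obtain ⟨t₀, ht₀, -⟩ := hG.exists_selection (I := ∅) (by simp [IsIndepSet])
  obtain ⟨S, hS, -, -, hcard⟩ :=
    hG.exists_isIndepSet hM hclosed ht₀ (v := u) ⟨_, hC, p.start_mem_verts_toSubgraph⟩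
  rw [hG.ncard_selected ht₀] at hcard
  have hle := IsIndepSet.card_le_indepNum (t := S.toFinite.toFinset) (by simpa using hS)
  rw [← Set.ncard_eq_toFinset_card S] at hle
  obtain ⟨I, hI⟩ := G.maximumIndepSet_exists
  obtain ⟨t, ht, hIt⟩ := hG.exists_selection hI.isIndepSet
  obtain ⟨K, hK, hKv, -, -⟩ := hG.exists_isMatching hM.1 hclosed ht
  have := two_mul_ncard_add_le hK (disjoint_exposed_selected ht) hKv hIt
    fun x y hxy hx hy => hI.isIndepSet hx hy hxy.ne hxy.adj_sub
  rw [hG.ncard_selected ht, Set.ncard_coe_finset, maximumIndepSet_card_eq_indepNum I hI] at this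
  omega

/-- Since a maximum independent set attains the upper bound that counting along the matching gives,
it contains every exposed vertex and an end of every matching edge outside the odd cycles. -/
lemma IsRDisjoint.exposed_subset_and_mem_iff (hG : IsRDisjoint G) (hM : IsMaximumMatching G M)
    (hclosed : ∀ C, IsOddCycle G C → ∀ x ∈ C.verts, ∀ y, M.Adj x y → y ∈ C.verts)
    {I : Finset V} (hI : G.IsMaximumIndepSet I) :
    exposed M ⊆ I ∧ ∀ x y, x ∉ oddVerts G → M.Adj x y → (x ∈ I ↔ y ∉ I) := by
  obtain ⟨t, ht, hIt⟩ := hG.exists_selection hI.isIndepSet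
  obtain ⟨K, hK, hKv, -, hMK⟩ := hG.exists_isMatching hM.1 hclosed ht
  have hind : ∀ x y, G.Adj x y → x ∈ I → y ∉ I := fun x y hxy hx hy =>
    hI.isIndepSet hx hy hxy.ne hxy
  obtain ⟨h1, h2⟩ := of_two_mul_ncard_add_eq hK (disjoint_exposed_selected ht) hKv hIt
    (fun x y hxy => hind x y hxy.adj_sub) (by
      rw [hG.ncard_selected ht, Set.ncard_coe_finset, maximumIndepSet_card_eq_indepNum I hI,
        hG.two_mul_indepNum_add hM hclosed])
  exact ⟨h1, fun x y hx hxy => ⟨hind x y hxy.adj_sub, (h2 x y (hMK x y hx hxy)).resolve_right⟩⟩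

/-- Some maximum independent set contains a given vertex of an odd cycle, and some does not. -/
lemma IsRDisjoint.mem_corona_and_notMem_core (hG : IsRDisjoint G) {v : V} (hv : v ∈ oddVerts G) :
    v ∈ corona G ∧ v ∉ core G := by
  classical
  obtain ⟨M, hM, hclosed⟩ := hG.exists_isMaximumMatching
  obtain ⟨C, hC, hvC⟩ := id hv
  obtain ⟨t₀, ht₀, -⟩ := hG.exists_selection (I := ∅) (by simp [IsIndepSet])
  -- A selection with a prescribed vertex `e` of `C`.
  have key : ∀ e ∈ C.verts, ∃ I : Finset V, G.IsMaximumIndepSet I ∧ e ∉ I ∧ (v ≠ e → v ∈ I) := by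
    intro e he
    have ht : ∀ C', IsOddCycle G C' → Function.update t₀ C e C' ∈ C'.verts := by
      intro C' hC'
      by_cases h : C' = C
      · subst h
        simpa using he
      · simpa [h] using ht₀ C' hC'
    obtain ⟨S, hS, hdisj, hvS, hcard⟩ := hG.exists_isIndepSet hM hclosed ht hv
    rw [hG.ncard_selected ht, ← hG.two_mul_indepNum_add hM hclosed] at hcard
    refine ⟨S.toFinite.toFinset, ⟨by simpa using hS, fun I hI => ?_⟩, ?_, fun hne => ?_⟩
    · rw [← Set.ncard_eq_toFinset_card S]
      have := IsIndepSet.card_le_indepNum hI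
      omega
    · simpa using Set.disjoint_right.1 hdisj ⟨C, hC, by simp⟩
    · rw [Set.Finite.mem_toFinset]
      refine hvS ?_
      rintro ⟨C', hC', h⟩
      obtain rfl := hG.eq_of_mem hC' hC (h ▸ ht C' hC') hvC
      exact hne (by simpa using h.symm)
  obtain ⟨e, he⟩ := hC.exists_adj hvC
  constructor
  · obtain ⟨I, hI, -, h⟩ := key e he.snd_mem
    exact ⟨I, hI, h he.ne⟩
  · obtain ⟨I, hI, h, -⟩ := key v hvC
    exact fun hcore => h (hcore I hI)

end CoronaCore

end RDisjointGraph

open RDisjointGraph in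
theorem mainTheorem3 {V : Type*} [Finite V] (G : SimpleGraph V) (k : ℕ)
    (hG : RDisjointGraph.IsRDisjoint G)
    (hk : {C : G.Subgraph | RDisjointGraph.IsOddCycle G C}.ncard = k) :
    (RDisjointGraph.corona G).ncard + (RDisjointGraph.core G).ncard = 2 * G.indepNum + k := by
  obtain ⟨M, hM, hclosed⟩ := hG.exists_isMaximumMatching
  have hX : ∀ x ∈ exposed M, x ∈ corona G ∧ x ∈ core G := by
    intro x hx
    obtain ⟨I, hI⟩ := G.maximumIndepSet_exists
    have h := fun I hI => (hG.exposed_subset_and_mem_iff hM hclosed (I := I) hI).1 hx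
    exact ⟨⟨I, hI, h I hI⟩, h⟩
  -- The edges of `M` outside the odd cycles.
  obtain ⟨K, hK, hKv, hKadj⟩ := exists_isMatching_replace (M₂ := ⊥) hM.1 (X := oddVerts G)
    (fun x ⟨C, hC, hx⟩ y hxy => ⟨C, hC, hclosed C hC x hx y hxy⟩)
    (fun _ h => h.elim) (by simp)
  have hswap : ∀ x y, K.Adj x y → (x ∈ corona G ↔ y ∉ core G) := by
    intro x y hxy
    have hxy' : x ∉ oddVerts G ∧ M.Adj x y := by simpa using (hKadj x y).1 hxy
    have h := fun I hI => (hG.exposed_subset_and_mem_iff hM hclosed (I := I) hI).2 x y hxy'.1 hxy'.2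
    constructor
    · rintro ⟨I, hI, hx⟩ hcore
      exact (h I hI).1 hx (hcore I hI)
    · intro hy
      simp only [core, Set.mem_ofPred_eq, not_forall] at hy
      obtain ⟨I, hI, hy⟩ := hy
      exact ⟨I, hI, (h I hI).2 hy⟩
  -- Taking mates maps the corona vertices of `K` bijectively to the vertices of `K` not in the core.
  have hle : (corona G ∩ K.verts).ncard ≤ ((core G)ᶜ ∩ K.verts).ncard :=
    ncard_inter_verts_le hK fun x y h => (hswap x y h).1
  have hge : ((core G)ᶜ ∩ K.verts).ncard ≤ (corona G ∩ K.verts).ncard :=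
    ncard_inter_verts_le hK fun x y h => (hswap y x h.symm).2
  have hKsplit := Set.ncard_inter_add_ncard_sdiff_eq_ncard K.verts (core G)
  rw [Set.inter_comm, Set.sdiff_eq, Set.inter_comm K.verts] at hKsplit
  have hUX : Disjoint (exposed M) (oddVerts G) :=
    Set.disjoint_left.2 fun x hx hx' => hx (Or.inr hx')
  have hKv' : K.verts = (exposed M ∪ oddVerts G)ᶜ := by
    ext x
    simp only [hKv, exposed, Subgraph.verts_bot, Set.mem_union, Set.mem_sdiff, Set.mem_compl_iff,
      Set.mem_empty_iff_false]
    tauto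
  have hcard := card_eq_of_verts_eq hUX hKv'
  have hcore := ncard_eq_of_disjoint hKv' (I := core G)
    (Set.disjoint_right.2 fun x hx => (hG.mem_corona_and_notMem_core hx).2)
  have hcorona : (corona G).ncard =
      (corona G ∩ K.verts).ncard + (exposed M).ncard + (oddVerts G).ncard := by
    rw [← Set.ncard_inter_add_ncard_sdiff_eq_ncard (corona G) K.verts, add_assoc,
      ← Set.ncard_union_eq hUX]
    congr 2
    rw [Set.sdiff_eq, hKv', compl_compl, Set.inter_eq_right]
    rintro x (hx | hx)
    · exact (hX x hx).1
    · exact (hG.mem_corona_and_notMem_core hx).1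
  rw [Set.inter_eq_right.2 fun x hx => (hX x hx).2] at hcore
  have := hG.two_mul_indepNum_add hM hclosed
  omega
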